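/- A real sequence $\{\gamma_k\}_{k\ge 0}$ is a multiplier sequence if the linear operator $T$ on $\mathbb{R}[x]$ with $T[x^k]=\gamma_k x^k$ ($k\ge 0$) maps every real polynomial without non-real zeros to a polynomial without non-real zeros (the zero polynomial is counted as having no non-real zeros). An entire function $\varphi(x)=\sum_{k\ge0}\frac{\gamma_k}{k!}x^k$ belongs to $\mathscr{L}\text{-}\mathscr{P}^+$ if $\gamma_k\ge 0$ for all $k$ and $\varphi(x)$ or $\varphi(-x)$ has the form $C x^m e^{\sigma x}\prod_{k=1}^{\omega}(1+x/x_k)$ with $C\in\mathbb{R}$, $m\in\mathbb{Z}_{\ge0}$, $\sigma\ge0$, $x_k>0$, $0\le\omega\le\infty$ and $\sum_{k=1}^{\omega}1/x_k<\infty$. For $p=0,1$ let $I_p(x)=(x/2)^p\sum_{k\ge0}\frac{(x/2)^{2k}}{k!\,\Gamma(k+p+1)}$ be the modified Bessel functions of the first kind. Let $p(x)=cx^2+ax+b$ with $a,b,c\ge 0$. Then: (1) $\left\{\frac{p(k)}{k!}\right\}_{k=0}^\infty$ is a multiplier sequence. (2) For every $x\in\mathbb{C}$ and either choice of the square root $\sqrt{x}$,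 the following series converges and $$\sum_{k=0}^\infty \frac{p(k)}{(k!)^2}x^k=(b+cx)\,I_0(2\sqrt{x})+a\sqrt{x}\,I_1(2\sqrt{x}).$$ (3) The entire function $\sum_{k=0}^\infty \frac{p(k)}{(k!)^2}x^k$ belongs to $\mathscr{L}\text{-}\mathscr{P}^+$. On the other hand, $\{p(k)\}_{k=0}^\infty$ itself need not be a multiplier sequence: $\{k^2+2\}_{k=0}^\infty$ is not one. -/

import Mathlib

open scoped Nat Polynomial

noncomputable section

/-- The linear operator `T` on real polynomials with `T[x^k] = γ_k x^k` for every `k`. -/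
def diagonalOperator (γ : ℕ → ℝ) : ℝ[X] →ₗ[ℝ] ℝ[X] :=
  (Polynomial.basisMonomials ℝ).constr ℝ (fun k => γ k • (Polynomial.X : ℝ[X]) ^ k)

theorem diagonalOperator_X_pow (γ : ℕ → ℝ) (k : ℕ) :
    diagonalOperator γ (Polynomial.X ^ k) = γ k • (Polynomial.X : ℝ[X]) ^ k := by
  have h := (Polynomial.basisMonomials ℝ).constr_basis ℝ
    (fun k => γ k • (Polynomial.X : ℝ[X]) ^ k) k
  simpa [diagonalOperator, Polynomial.monomial_one_right_eq_X_pow] using h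

open Classical in
/-- The number of non-real zeros of a real polynomial, counted with multiplicity
(with the value `0` for the zero polynomial). -/
def nonrealZeroCount (p : ℝ[X]) : ℕ :=
  Multiset.card ((p.aroots ℂ).filter (fun z => z.im ≠ 0))

/-- Classical multiplier sequences (of the first kind). -/
def IsMultiplierSequence (γ : ℕ → ℝ) : Prop :=
  ∀ p : ℝ[X], nonrealZeroCount p = 0 → nonrealZeroCount (diagonalOperator γ p) = 0

/-- `f` is the real entire function `f(z) = ∑ (γ_k / k!) z^k`. -/
def IsRealEntireWith (f : ℂ → ℂ) (γ : ℕ → ℝ) : Prop :=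
  ∀ z : ℂ, HasSum (fun k : ℕ => ((γ k / (k ! : ℝ) : ℝ) : ℂ) * z ^ k) (f z)

/-- `f(z) = c z^m e^{σ z} ∏_{k < ω} (1 + z / x_k)` with `c` real, `σ ≥ 0`, `x_k > 0`,
`0 ≤ ω ≤ ∞` and `∑_{k < ω} 1 / x_k < ∞`. (The summability makes the product converge
absolutely, so that the unconditional product below is the usual one.) -/
def HasTypeIRepresentation (f : ℂ → ℂ) : Prop :=
  ∃ (c : ℝ) (m : ℕ) (σ : ℝ) (ω : ℕ∞) (x : {k : ℕ // (k : ℕ∞) < ω} → ℝ),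
    0 ≤ σ ∧ (∀ k, 0 < x k) ∧ Summable (fun k => 1 / x k) ∧
    ∀ z : ℂ, f z = (c : ℂ) * z ^ m * Complex.exp ((σ : ℂ) * z) * ∏' k, (1 + z / (x k : ℂ))

/-- The class of real entire functions `f(z) = ∑ (γ_k / k!) z^k` of type I in the
Laguerre–Pólya class (`f(z)` or `f(-z)` has the representation above) with all `γ_k ≥ 0`. -/
def IsLaguerrePolyaPlus (f : ℂ → ℂ) : Prop :=
  ∃ γ : ℕ → ℝ, IsRealEntireWith f γ ∧
    (HasTypeIRepresentation f ∨ HasTypeIRepresentation (fun z => f (-z))) ∧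
    ∀ k, 0 ≤ γ k

/-- The modified Bessel function of the first kind of order `p`,
`I_p(z) = (z/2)^p ∑ (z/2)^{2k} / (k! Γ(k+p+1))`. -/
def besselI (p : ℝ) (z : ℂ) : ℂ :=
  (z / 2) ^ (p : ℂ) *
    ∑' k : ℕ, (z / 2) ^ (2 * k) / ((k ! : ℂ) * Complex.Gamma ((k : ℂ) + (p : ℂ) + 1))

end

/-!
Everything rests on polynomials without zeros in the open upper half-plane (`HStable`). For such
a `P` the logarithmic derivative `P'/P = ∑ 1 / (y - w)` has negative imaginary part on the upper
half-plane, and the stability statements below all come from this fact and from passage to limits.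

* `P + P'` is stable if `P` is, so `(1 + d/dx)^n x^n = n! L_n(-x)` is: the polynomials
  `g_n(x) = L_n(-x / n)` have only real zeros. Their coefficients tend to `1 / k!²`.
* `(b + c x) g_n + a x g_n'` is stable for `a, b, c ≥ 0`, `b > 0`, because divided by `x g_n` it is
  `c + b / x + a g_n' / g_n`, of negative imaginary part. Its coefficients tend to
  `(c k² + a k + b) / k!²`. Hence the series in question is a limit of polynomials with
  non-negative coefficients and only real zeros (`isStableLimit_quadratic`).
* If `Q` has negative zeros, `Q(x d/dy)` is a product of operators `x d/dy + s` with `s > 0`, which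
  preserve stability in `y` for `Im x ≥ 0`; letting `y → 0` yields Schur's composition theorem
  (`HStable.schur_comp`). Passing to the limit over `Q` shows that `(c k² + a k + b) / k!` is a
  multiplier sequence (`IsStableLimit.isMultiplierSequence`).
* For the product representation, the approximants are written `Q(0) ∏ (1 + r_j z)` with
  `r_j ≥ 0` decreasing and `∑ r_j = Q'(0) / Q(0)` bounded, so that `r_j ≤ S / (j + 1)`. Compactness
  gives a subsequence along which all `r_j` converge, and the genus-one products
  `∏ (1 + r_j z) e^{-r_j z}` converge by domination (`IsStableLimit.exists_type_I`). If `b = 0`, a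
  factor `x` is removed first (`isStableLimit_quadratic_succ`).

The Bessel identity is a comparison of power series, with `z ∑ z^k / (k! (k+1)!) = ∑ k z^k / k!²`.
The sequence `k² + 2` sends `(x + 1)²` to `6 x² + 6 x + 2`, which has non-real zeros.
-/

section

open Polynomial Filter Topology

/-! ### Stable polynomials and Schur's composition theorem -/

/-- A complex polynomial is *stable* if it has no zero in the open upper half-plane.
In particular the zero polynomial is not stable. -/
def HStable (P : ℂ[X]) : Prop := ∀ y : ℂ, 0 < y.im → P.eval y ≠ 0

theorem HStable.ne_zero {P : ℂ[X]} (hP : HStable P) : P ≠ 0 := by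
  rintro rfl
  exact hP Complex.I (by simp) (by simp)

theorem HStable.im_root_nonpos {P : ℂ[X]} (hP : HStable P) {w : ℂ} (hw : w ∈ P.roots) :
    w.im ≤ 0 := by
  by_contra h
  exact hP w (not_le.mp h) (isRoot_of_mem_roots hw)

/-- On the upper half-plane the logarithmic derivative `∑ 1 / (y - w)` of a stable polynomial
has negative imaginary part, unless the polynomial is constant. -/
theorem HStable.exists_logDeriv {P : ℂ[X]} (hP : HStable P) {y : ℂ} (hy : 0 < y.im) :
    ∃ q : ℂ, P.derivative.eval y = P.eval y * q ∧ (q = 0 ∨ q.im < 0) := by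
  refine ⟨_, (IsAlgClosed.splits P).eval_derivative_eq_eval_mul_sum (hP y hy), ?_⟩
  have key : ∀ s : Multiset ℂ, (∀ w ∈ s, w.im ≤ 0) →
      ((s.map fun w ↦ 1 / (y - w)).sum = 0 ∨ (s.map fun w ↦ 1 / (y - w)).sum.im < 0) := by
    intro s
    induction s using Multiset.induction_on with
    | empty => simp
    | cons w s ih =>
      intro h
      right
      have h1 : 0 < (y - w).im := by
        have := h w (Multiset.mem_cons_self w s)
        simp only [Complex.sub_im]
        linarith
      have h2 : (1 / (y - w)).im < 0 := by
        rw [one_div, Complex.inv_im]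
        have : 0 < Complex.normSq (y - w) :=
          Complex.normSq_pos.mpr fun h0 => by simp [h0] at h1
        exact div_neg_of_neg_of_pos (by linarith) this
      have h3 := ih fun v hv => h v (Multiset.mem_cons_of_mem hv)
      simp only [Multiset.map_cons, Multiset.sum_cons, Complex.add_im]
      rcases h3 with h3 | h3
      · rw [h3]
        simpa using h2
      · linarith
  exact key _ fun w hw => hP.im_root_nonpos hw

/-- The Hermite–Poulain step: `x P' + s P` is stable together with `P` when `0 ≤ Im x` and
`0 < s`, because a zero `y` would give `P'(y) / P(y) = -s / x`, whose imaginary part is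
non-negative. -/
theorem HStable.derivative_add {P : ℂ[X]} (hP : HStable P) {x : ℂ} (hx : 0 ≤ x.im) {s : ℝ}
    (hs : 0 < s) : HStable (C x * derivative P + C (s : ℂ) * P) := by
  intro y hy h0
  obtain ⟨q, hq, hq'⟩ := hP.exists_logDeriv hy
  have h1 : P.eval y * (x * q + s) = 0 := by
    simp only [eval_add, eval_mul, eval_C, hq] at h0
    linear_combination h0
  have h2 : x * q + s = 0 := (mul_eq_zero.mp h1).resolve_left (hP y hy)
  have hs' : (s : ℂ) ≠ 0 := by exact_mod_cast hs.ne'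
  rcases hq' with rfl | hq'
  · exact hs' (by simpa using h2)
  · have hq0 : q ≠ 0 := fun h => by simp [h] at hq'
    have hx' : x = -s * q⁻¹ := by
      field_simp
      linear_combination h2
    have : x.im = s * q.im / Complex.normSq q := by
      rw [hx', ← Complex.ofReal_neg, Complex.im_ofReal_mul, Complex.inv_im]
      ring
    have h3 : s * q.im / Complex.normSq q < 0 :=
      div_neg_of_neg_of_pos (by nlinarith) (Complex.normSq_pos.mpr hq0)
    linarith

/-- If `g` is stable then so is `(b + c X) g + a X g'`: divided by `y g(y)` its value is
`c + b / y + a g'(y) / g(y)`, of negative imaginary part. -/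
theorem HStable.linear_mul_add {g : ℂ[X]} (hg : HStable g) {a b c : ℝ} (ha : 0 ≤ a)
    (hb : 0 < b) :
    HStable ((C (b : ℂ) + C (c : ℂ) * X) * g + C (a : ℂ) * X * derivative g) := by
  intro y hy h0
  obtain ⟨q, hq, hq'⟩ := hg.exists_logDeriv hy
  have hy0 : y ≠ 0 := fun h => by simp [h] at hy
  have h1 : g.eval y * (b + c * y + a * y * q) = 0 := by
    simp only [eval_add, eval_mul, eval_C, eval_X, hq] at h0
    linear_combination h0
  have h2 := (mul_eq_zero.mp h1).resolve_left (hg y hy)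
  have h3 : (b : ℂ) * y⁻¹ + c + a * q = 0 := by
    field_simp
    linear_combination h2
  have h4 := congrArg Complex.im h3
  simp only [Complex.add_im, Complex.im_ofReal_mul, Complex.inv_im, Complex.ofReal_im,
    Complex.zero_im] at h4
  have h5 : -y.im / Complex.normSq y < 0 :=
    div_neg_of_neg_of_pos (by linarith) (Complex.normSq_pos.mpr hy0)
  have h6 : q.im ≤ 0 := by
    rcases hq' with rfl | h
    · simp
    · exact h.le
  nlinarith [mul_nonneg ha (neg_nonneg.mpr h6), mul_pos hb (neg_pos.mpr h5)]

theorem HStable.comp_mul_X {P : ℂ[X]} (hP : HStable P) {r : ℝ} (hr : 0 < r) :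
    HStable (P.comp (C (r : ℂ) * X)) := by
  intro y hy
  rw [eval_comp]
  apply hP
  simpa using mul_pos hr hy

theorem hStable_X_pow (n : ℕ) : HStable (X ^ n : ℂ[X]) := by
  intro y hy
  have hy0 : y ≠ 0 := fun h => by simp [h] at hy
  simp [hy0]

/-- For a stable `P`, the zeros stay at distance at least `Im z₀` from `z₀`, so that the size
of `P` at `z₀` controls its size at every point. -/
theorem HStable.norm_eval_le {P : ℂ[X]} (hP : HStable P) {z₀ : ℂ} (h₀ : 0 < z₀.im) (z : ℂ) :
    ‖P.eval z‖ ≤ (1 + ‖z - z₀‖ / z₀.im) ^ P.natDegree * ‖P.eval z₀‖ := by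
  have hs := IsAlgClosed.splits P
  have key : ∀ s : Multiset ℂ, (∀ w ∈ s, w.im ≤ 0) →
      ‖(s.map (z - ·)).prod‖ ≤
        (1 + ‖z - z₀‖ / z₀.im) ^ (Multiset.card s) * ‖(s.map (z₀ - ·)).prod‖ := by
    intro s
    induction s using Multiset.induction_on with
    | empty => simp
    | cons w s ih =>
      intro h
      have h1 := ih fun v hv => h v (Multiset.mem_cons_of_mem hv)
      have h2 : z₀.im ≤ ‖z₀ - w‖ := by
        have h3 := (le_abs_self _).trans (Complex.abs_im_le_norm (z₀ - w))
        have := h w (Multiset.mem_cons_self w s)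
        simp only [Complex.sub_im] at h3
        linarith
      have h4 : ‖z - w‖ ≤ (1 + ‖z - z₀‖ / z₀.im) * ‖z₀ - w‖ := by
        have h5 : ‖z - w‖ ≤ ‖z - z₀‖ + ‖z₀ - w‖ := by
          simpa using norm_add_le (z - z₀) (z₀ - w)
        have h6 : ‖z - z₀‖ ≤ ‖z - z₀‖ / z₀.im * ‖z₀ - w‖ := by
          rw [div_mul_eq_mul_div, le_div_iff₀ h₀]
          gcongr
        linarith
      simp only [Multiset.map_cons, Multiset.prod_cons, Multiset.card_cons, norm_mul, pow_succ]
      calc _ ≤ _ := mul_le_mul h4 h1 (norm_nonneg _) (by positivity)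
        _ = _ := by ring
  rw [hs.eval_eq_prod_roots, hs.eval_eq_prod_roots, norm_mul, norm_mul,
    hs.natDegree_eq_card_roots]
  calc _ ≤ _ := mul_le_mul_of_nonneg_left (key _ fun w hw => hP.im_root_nonpos hw)
        (norm_nonneg _)
    _ = _ := by ring

/-- A Hurwitz theorem for polynomials of bounded degree: a pointwise limit of
polynomials that are stable or zero is stable or zero. -/
theorem eq_zero_or_hStable_of_tendsto {ι : Type*} {l : Filter ι} [l.NeBot] {P : ι → ℂ[X]}
    {Q : ℂ[X]} (N : ℕ) (hN : ∀ i, (P i).natDegree ≤ N)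
    (hP : ∀ᶠ i in l, P i = 0 ∨ HStable (P i))
    (h : ∀ z : ℂ, Tendsto (fun i => (P i).eval z) l (𝓝 (Q.eval z))) :
    Q = 0 ∨ HStable Q := by
  by_contra! hcon
  obtain ⟨hQ0, hQ⟩ := hcon
  simp only [HStable, not_forall, not_not] at hQ
  obtain ⟨z₀, hz₀, h0⟩ := hQ
  refine hQ0 (Polynomial.funext fun z => ?_)
  rw [eval_zero, ← norm_le_zero_iff]
  have h1 : Tendsto (fun i => (1 + ‖z - z₀‖ / z₀.im) ^ N * ‖(P i).eval z₀‖) l (𝓝 0) := by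
    simpa [h0] using ((h z₀).norm.const_mul ((1 + ‖z - z₀‖ / z₀.im) ^ N))
  refine le_of_tendsto_of_tendsto (h z).norm h1 (hP.mono fun i hi => ?_)
  rcases hi with hi | hi
  · simp [hi]
  refine (hi.norm_eval_le hz₀ z).trans ?_
  beta_reduce
  gcongr
  · simp only [le_add_iff_nonneg_right]; positivity
  · exact hN i

/-- The operator `Q(x d/dy)` preserves stability for `0 ≤ Im x` when all zeros of `Q` are
negative reals: each linear factor is a Hermite–Poulain step. -/
theorem HStable.aeval_derivative {f Q : ℂ[X]} (hf : HStable f) (hQ0 : Q ≠ 0)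
    (hQ : ∀ w ∈ Q.roots, ∃ s : ℝ, 0 < s ∧ w = -(s : ℂ)) {x : ℂ} (hx : 0 ≤ x.im) :
    HStable (aeval (x • (derivative : ℂ[X] →ₗ[ℂ] ℂ[X])) Q f) := by
  have key : ∀ s : Multiset ℂ, (∀ w ∈ s, ∃ r : ℝ, 0 < r ∧ w = -(r : ℂ)) →
      HStable (aeval (x • (derivative : ℂ[X] →ₗ[ℂ] ℂ[X])) (s.map (X - C ·)).prod f) := by
    intro s
    induction s using Multiset.induction_on with
    | empty => simpa using hf
    | cons w s ih =>
      intro h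
      obtain ⟨r, hr, rfl⟩ := h w (Multiset.mem_cons_self w s)
      have := (ih fun v hv => h v (Multiset.mem_cons_of_mem hv)).derivative_add hx hr
      simpa [Module.End.mul_apply, smul_eq_C_mul, Module.algebraMap_end_apply] using this
  rw [(IsAlgClosed.splits Q).eq_prod_roots, map_mul, aeval_C, Module.End.mul_apply,
    Module.algebraMap_end_apply]
  intro y hy
  rw [eval_smul, smul_eq_mul]
  exact mul_ne_zero (leadingCoeff_ne_zero.mpr hQ0) (key _ hQ y hy)

/-- Schur's composition theorem: for a stable `f = ∑ a_k x^k` and a polynomial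
`Q = ∑ b_k x^k` with negative real zeros, `∑ k! b_k a_k x^k` is stable or zero. It is the
limit, as `ε → 0⁺`, of the polynomial `x ↦ (Q(x d/dy) f)(iε)`. -/
theorem HStable.schur_comp {f Q : ℂ[X]} (hf : HStable f) (hQ0 : Q ≠ 0)
    (hQ : ∀ w ∈ Q.roots, ∃ s : ℝ, 0 < s ∧ w = -(s : ℂ)) :
    (∑ k ∈ Finset.range (Q.natDegree + 1), C (Q.coeff k * (k ! * f.coeff k)) * X ^ k = 0) ∨
      HStable (∑ k ∈ Finset.range (Q.natDegree + 1),
        C (Q.coeff k * (k ! * f.coeff k)) * X ^ k) := by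
  have hpow : ∀ (z : ℂ) (k : ℕ), ((z • (derivative : ℂ[X] →ₗ[ℂ] ℂ[X])) ^ k) f =
      z ^ k • derivative^[k] f := by
    intro z k
    rw [_root_.smul_pow, LinearMap.smul_apply, Module.End.pow_apply]
  refine eq_zero_or_hStable_of_tendsto (l := 𝓝[>] (0 : ℝ))
    (P := fun ε => ∑ k ∈ Finset.range (Q.natDegree + 1),
      C (Q.coeff k * (derivative^[k] f).eval (ε * Complex.I)) * X ^ k)
    Q.natDegree (fun ε => ?_) ?_ fun z => ?_
  · refine natDegree_sum_le_of_forall_le _ _ fun k hk => ?_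
    refine (natDegree_C_mul_X_pow_le _ _).trans ?_
    simp only [Finset.mem_range] at hk
    omega
  · filter_upwards [self_mem_nhdsWithin] with ε hε
    refine Or.inr fun z hz => ?_
    have h := hf.aeval_derivative hQ0 hQ hz.le (ε * Complex.I) (by simpa using hε)
    rw [aeval_eq_sum_range, LinearMap.sum_apply, eval_finsetSum] at h
    rw [eval_finsetSum]
    convert h using 2 with k hk
    rw [LinearMap.smul_apply, hpow]
    simp only [eval_mul, eval_C, eval_pow, eval_X, eval_smul, smul_eq_mul]
    ring
  · simp only [eval_finsetSum, eval_mul, eval_C, eval_pow, eval_X]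
    refine tendsto_finsetSum _ fun k _ => Tendsto.mul_const _ (Tendsto.const_mul _ ?_)
    have h0 : (k ! : ℂ) * f.coeff k = (derivative^[k] f).eval (((0 : ℝ) : ℂ) * Complex.I) := by
      have := coeff_iterate_derivative (p := f) (k := k) 0
      rw [Complex.ofReal_zero, zero_mul, ← coeff_zero_eq_eval_zero, this]
      simp [Nat.descFactorial_self]
    rw [h0]
    have hc : Continuous fun ε : ℝ => (derivative^[k] f).eval ((ε : ℂ) * Complex.I) := by
      fun_prop
    exact (hc.tendsto 0).mono_left nhdsWithin_le_nhds

/-! ### Multiplier sequences and Laguerre polynomials -/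

theorem diagonalOperator_coeff (γ : ℕ → ℝ) (p : ℝ[X]) (k : ℕ) :
    (diagonalOperator γ p).coeff k = γ k * p.coeff k := by
  induction p using Polynomial.induction_on' with
  | add p q hp hq => rw [map_add, coeff_add, coeff_add, hp, hq, mul_add]
  | monomial n a =>
    rw [← C_mul_X_pow_eq_monomial, ← smul_eq_C_mul, map_smul, diagonalOperator_X_pow]
    simp only [coeff_smul, coeff_X_pow, smul_eq_mul]
    split_ifs with h
    · subst h; ring
    · simp

theorem nonrealZeroCount_eq_zero_iff (p : ℝ[X]) :
    nonrealZeroCount p = 0 ↔ p = 0 ∨ HStable (p.map (algebraMap ℝ ℂ)) := by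
  rw [nonrealZeroCount, Multiset.card_eq_zero, Multiset.filter_eq_nil]
  by_cases hp : p = 0
  · simp [hp]
  simp only [hp, false_or, mem_aroots, ne_eq, not_not, not_false_eq_true, true_and, HStable,
    eval_map_algebraMap]
  refine ⟨fun h y hy h0 => hy.ne' (h y h0), fun h y h0 => ?_⟩
  rcases lt_trichotomy y.im 0 with hy | hy | hy
  · refine absurd ?_ (h (starRingEnd ℂ y) (by simpa using hy))
    rw [aeval_conj, h0, map_zero]
  · exact hy
  · exact absurd h0 (h y hy)

theorem exists_pos_eq_neg_of_mem_roots {Q : ℝ[X]} (hQ : HStable (Q.map (algebraMap ℝ ℂ)))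
    (hnn : ∀ k, 0 ≤ Q.coeff k) (h0 : 0 < Q.coeff 0) :
    ∀ w ∈ (Q.map (algebraMap ℝ ℂ)).roots, ∃ s : ℝ, 0 < s ∧ w = -(s : ℂ) := by
  intro w hw
  have him : w.im = 0 := by
    have h1 := (nonrealZeroCount_eq_zero_iff Q).mpr (Or.inr hQ)
    rw [nonrealZeroCount, Multiset.card_eq_zero, Multiset.filter_eq_nil] at h1
    exact not_not.mp (h1 w hw)
  have hw' : w = (w.re : ℂ) := Complex.ext (by simp) (by simp [him])
  refine ⟨-w.re, ?_, by rw [Complex.ofReal_neg, neg_neg]; exact hw'⟩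
  by_contra! hneg
  have h2 : (Q.map (algebraMap ℝ ℂ)).eval w = 0 := isRoot_of_mem_roots hw
  rw [hw', ← Complex.coe_algebraMap, eval_map, eval₂_at_apply] at h2
  have h3 : Q.eval w.re = 0 := by
    rw [Complex.coe_algebraMap] at h2
    exact_mod_cast h2
  rw [eval_eq_sum_range] at h3
  have h4 := Finset.single_le_sum (f := fun i => Q.coeff i * w.re ^ i)
    (fun i _ => mul_nonneg (hnn i) (pow_nonneg (by linarith) i))
    (Finset.mem_range.mpr (Nat.succ_pos Q.natDegree))
  simp only [pow_zero, mul_one] at h4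
  linarith

/-- The sequence `β` is the coefficientwise limit of real polynomials that have non-negative
coefficients, a positive constant term, and only real zeros. -/
def IsStableLimit (β : ℕ → ℝ) : Prop :=
  ∃ Q : ℕ → ℝ[X], (∀ n, HStable ((Q n).map (algebraMap ℝ ℂ))) ∧
    (∀ n k, 0 ≤ (Q n).coeff k) ∧ (∀ n, 0 < (Q n).coeff 0) ∧
    ∀ k, Tendsto (fun n => (Q n).coeff k) atTop (𝓝 (β k))

/-- The sufficient direction of the Pólya–Schur theorem, obtained by passing to the limit in
Schur's composition theorem. -/
theorem IsStableLimit.isMultiplierSequence {β : ℕ → ℝ} (h : IsStableLimit β) :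
    IsMultiplierSequence fun k => (k ! : ℝ) * β k := by
  obtain ⟨Q, hQ, hnn, h0, hlim⟩ := h
  intro p hp
  rw [nonrealZeroCount_eq_zero_iff] at hp ⊢
  rcases hp with rfl | hp
  · simp
  set D := diagonalOperator (fun k => (k ! : ℝ) * β k) p with hD
  have hcoeff : ∀ n k, (∑ j ∈ Finset.range (((Q n).map (algebraMap ℝ ℂ)).natDegree + 1),
      C (((Q n).map (algebraMap ℝ ℂ)).coeff j * (j ! * (p.map (algebraMap ℝ ℂ)).coeff j)) *
        X ^ j).coeff k = ((Q n).coeff k : ℂ) * (k ! * p.coeff k) := by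
    intro n k
    rw [finsetSum_coeff]
    simp only [coeff_C_mul_X_pow, Finset.sum_ite_eq, Finset.mem_range]
    split_ifs with hk
    · simp
    · have : ((Q n).map (algebraMap ℝ ℂ)).coeff k = 0 := coeff_eq_zero_of_natDegree_lt (by omega)
      rw [coeff_map] at this
      rw [← Complex.coe_algebraMap, this, zero_mul]
  have hdeg : ∀ R : ℂ[X], (∀ k, p.coeff k = 0 → R.coeff k = 0) →
      R.natDegree ≤ p.natDegree := by
    intro R hR
    refine natDegree_le_iff_coeff_eq_zero.mpr fun k hk => ?_
    exact hR k (coeff_eq_zero_of_natDegree_lt hk)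
  have key := eq_zero_or_hStable_of_tendsto (l := atTop) (Q := D.map (algebraMap ℝ ℂ))
    (P := fun n => ∑ j ∈ Finset.range (((Q n).map (algebraMap ℝ ℂ)).natDegree + 1),
      C (((Q n).map (algebraMap ℝ ℂ)).coeff j * (j ! * (p.map (algebraMap ℝ ℂ)).coeff j)) *
        X ^ j) p.natDegree
    (fun n => hdeg _ fun k hk => by rw [hcoeff, hk]; simp)
    (Eventually.of_forall fun n => hp.schur_comp (hQ n).ne_zero
      (exists_pos_eq_neg_of_mem_roots (hQ n) (hnn n) (h0 n)))
    (fun z => ?_)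
  · refine key.imp_left fun h => ?_
    exact (Polynomial.map_eq_zero _).mp h
  · have hDdeg : (D.map (algebraMap ℝ ℂ)).natDegree ≤ p.natDegree :=
      hdeg _ fun k hk => by simp [hD, diagonalOperator_coeff, hk]
    rw [eval_eq_sum_range' (Nat.lt_succ_of_le hDdeg)]
    refine Tendsto.congr (f₁ := fun n => ∑ k ∈ Finset.range (p.natDegree + 1),
      ((Q n).coeff k : ℂ) * (k ! * p.coeff k) * z ^ k) (fun n => ?_) ?_
    · rw [eval_eq_sum_range' (Nat.lt_succ_of_le
        (hdeg _ fun k hk => by rw [hcoeff, hk]; simp) : _ < p.natDegree + 1)]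
      simp only [hcoeff]
    · refine tendsto_finsetSum _ fun k _ => Tendsto.mul_const _ ?_
      have : (D.map (algebraMap ℝ ℂ)).coeff k = (β k : ℂ) * (k ! * p.coeff k) := by
        rw [coeff_map, hD, diagonalOperator_coeff]
        simp only [Complex.coe_algebraMap]
        push_cast
        ring
      rw [this]
      exact ((Complex.continuous_ofReal.tendsto _).comp (hlim k)).mul_const _

/-- The polynomial `L_n(-x / n)`, with `L_n` the `n`-th Laguerre polynomial. -/
noncomputable def scaledLaguerre (n : ℕ) : ℝ[X] :=
  ∑ k ∈ Finset.range (n + 1), C ((n.choose k : ℝ) / ((k ! : ℝ) * (n : ℝ) ^ k)) * X ^ k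

theorem scaledLaguerre_coeff (n k : ℕ) :
    (scaledLaguerre n).coeff k = (n.choose k : ℝ) / ((k ! : ℝ) * (n : ℝ) ^ k) := by
  rw [scaledLaguerre, finsetSum_coeff]
  simp only [coeff_C_mul_X_pow, Finset.sum_ite_eq, Finset.mem_range]
  split_ifs with hk
  · rfl
  · rw [Nat.choose_eq_zero_of_lt (by omega)]; simp

theorem scaledLaguerre_coeff_nonneg (n k : ℕ) : 0 ≤ (scaledLaguerre n).coeff k := by
  rw [scaledLaguerre_coeff]; positivity

theorem tendsto_scaledLaguerre_coeff (k : ℕ) :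
    Tendsto (fun n => (scaledLaguerre n).coeff k) atTop (𝓝 (1 / (k ! : ℝ) ^ 2)) := by
  simp only [scaledLaguerre_coeff]
  have hk : (k ! : ℝ) ≠ 0 := by positivity
  have h := (Asymptotics.isEquivalent_iff_tendsto_one (by
    filter_upwards [eventually_gt_atTop 0] with n hn
    positivity)).mp (isEquivalent_choose k)
  have h2 := h.mul_const (1 / (k ! : ℝ) ^ 2)
  rw [one_mul] at h2
  refine h2.congr' ?_
  filter_upwards [eventually_gt_atTop 0] with n hn
  have hn' : (n : ℝ) ≠ 0 := by positivity
  simp only [Pi.div_apply]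
  field_simp

/-- `n! L_n(-x) = (1 + d/dx)^n x^n`, a form of Rodrigues' formula. -/
theorem one_add_derivative_pow_X_pow (n : ℕ) :
    ((derivative + 1 : Module.End ℂ ℂ[X]) ^ n) (X ^ n) =
      ∑ k ∈ Finset.range (n + 1), C ((n ! : ℂ) * (n.choose k / k !)) * X ^ k := by
  rw [(Commute.one_right _).add_pow, LinearMap.sum_apply, ← Finset.sum_flip]
  refine Finset.sum_congr rfl fun k hk => ?_
  have hk' : k ≤ n := Nat.lt_succ_iff.mp (Finset.mem_range.mp hk)
  have h1 : (n.descFactorial (n - k) : ℂ) = n ! / k ! := by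
    rw [eq_div_iff (by exact_mod_cast Nat.factorial_ne_zero k)]
    have := Nat.factorial_mul_descFactorial (Nat.sub_le n k)
    rw [Nat.sub_sub_self hk'] at this
    rw [mul_comm]
    exact_mod_cast this
  rw [Nat.choose_symm hk', one_pow, mul_one, ← nsmul_eq_mul', LinearMap.smul_apply,
    Module.End.pow_apply, iterate_derivative_X_pow_eq_C_mul, Nat.sub_sub_self hk', nsmul_eq_mul,
    h1, ← C_eq_natCast, ← mul_assoc, ← C_mul]
  congr 2
  ring

theorem hStable_scaledLaguerre (n : ℕ) : HStable ((scaledLaguerre n).map (algebraMap ℝ ℂ)) := by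
  rcases Nat.eq_zero_or_pos n with rfl | hn
  · intro y _
    simp [scaledLaguerre]
  have h1 : ∀ m : ℕ, HStable (((derivative + 1 : Module.End ℂ ℂ[X]) ^ m) (X ^ n)) := by
    intro m
    induction m with
    | zero => simpa using hStable_X_pow n
    | succ m ih =>
      have := ih.derivative_add (x := 1) (by simp) one_pos
      rw [pow_succ', Module.End.mul_apply]
      simpa using this
  have hr : (0 : ℝ) < 1 / n := by positivity
  have h2 := (h1 n).comp_mul_X hr
  have h3 : (((derivative + 1 : Module.End ℂ ℂ[X]) ^ n) (X ^ n)).comp (C ((1 / n : ℝ) : ℂ) * X) =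
      C (n ! : ℂ) * (scaledLaguerre n).map (algebraMap ℝ ℂ) := by
    rw [one_add_derivative_pow_X_pow, scaledLaguerre, Polynomial.map_sum, Polynomial.sum_comp,
      Finset.mul_sum]
    refine Finset.sum_congr rfl fun k _ => ?_
    simp only [mul_comp, C_comp, pow_comp, X_comp, Polynomial.map_mul, map_C, Polynomial.map_pow,
      map_X, mul_pow, ← C_pow]
    rw [← mul_assoc, ← mul_assoc, ← C_mul, ← C_mul]
    congr 2
    have hn' : (n : ℂ) ≠ 0 := by exact_mod_cast hn.ne'
    have hk : (k ! : ℂ) ≠ 0 := by exact_mod_cast Nat.factorial_ne_zero k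
    simp only [Complex.coe_algebraMap]
    push_cast
    rw [one_div, inv_pow]
    field_simp
  rw [h3] at h2
  intro y hy h0
  exact h2 y hy (by rw [eval_mul, h0, mul_zero])

theorem isStableLimit_quadratic {a b c : ℝ} (ha : 0 ≤ a) (hb : 0 ≤ b) (hc : 0 ≤ c) :
    IsStableLimit fun k => (c * (k : ℝ) ^ 2 + a * k + b) / (k ! : ℝ) ^ 2 := by
  -- The perturbation of `b` keeps the constant term positive when `b = 0`.
  set B : ℕ → ℝ := fun n => b + 1 / ((n : ℝ) + 1) with hB
  have hBpos : ∀ n, 0 < B n := fun n => by positivity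
  have hBlim : Tendsto B atTop (𝓝 b) := by
    simpa [hB] using tendsto_one_div_add_atTop_nhds_zero_nat.const_add b
  set Q : ℕ → ℝ[X] := fun n => (C (B n) + C c * X) * scaledLaguerre n +
    C a * X * derivative (scaledLaguerre n) with hQ
  have hz : ∀ n, (Q n).coeff 0 = B n * (scaledLaguerre n).coeff 0 := fun n => by
    simp [hQ, add_mul, mul_assoc]
  have hsucc : ∀ n k, (Q n).coeff (k + 1) = B n * (scaledLaguerre n).coeff (k + 1) +
      c * (scaledLaguerre n).coeff k + a * ((scaledLaguerre n).coeff (k + 1) * (k + 1)) := by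
    intro n k
    simp [hQ, add_mul, mul_assoc, coeff_X_mul, coeff_derivative]
  refine ⟨Q, fun n => ?_, fun n k => ?_, fun n => ?_, fun k => ?_⟩
  · have := (hStable_scaledLaguerre n).linear_mul_add (c := c) ha (hBpos n)
    simpa [hQ, derivative_map] using this
  · have h := scaledLaguerre_coeff_nonneg n
    cases k with
    | zero => rw [hz]; exact mul_nonneg (hBpos n).le (h 0)
    | succ k =>
      rw [hsucc]
      have h1 := h k
      have h2 := h (k + 1)
      have h3 := (hBpos n).le
      positivity
  · rw [hz, scaledLaguerre_coeff]
    simpa using hBpos n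
  · cases k with
    | zero =>
      simp only [hz]
      have := hBlim.mul (tendsto_scaledLaguerre_coeff 0)
      simpa using this
    | succ k =>
      simp only [hsucc]
      have h1 := tendsto_scaledLaguerre_coeff (k + 1)
      have h2 := tendsto_scaledLaguerre_coeff k
      have := ((hBlim.mul h1).add (h2.const_mul c)).add ((h1.mul_const ((k : ℝ) + 1)).const_mul a)
      convert this using 2
      rw [Nat.factorial_succ]
      push_cast
      have hk : (k ! : ℝ) ≠ 0 := by positivity
      have hk1 : (k : ℝ) + 1 ≠ 0 := by positivity
      field_simp
      ring

/-- The case of vanishing constant term, with one factor `x` removed from the power series. -/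
theorem isStableLimit_quadratic_succ {a c : ℝ} (ha : 0 ≤ a) (hc : 0 ≤ c) :
    IsStableLimit fun k =>
      (c * ((k + 1 : ℕ) : ℝ) ^ 2 + a * ((k + 1 : ℕ) : ℝ)) / ((k + 1)! : ℝ) ^ 2 := by
  -- The perturbation of `c` keeps the constant term positive when `c = 0`.
  set B : ℕ → ℝ := fun n => c + 1 / ((n : ℝ) + 1) with hB
  have hBpos : ∀ n, 0 < B n := fun n => by positivity
  have hBlim : Tendsto B atTop (𝓝 c) := by
    simpa [hB] using tendsto_one_div_add_atTop_nhds_zero_nat.const_add c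
  set Q : ℕ → ℝ[X] := fun n => C a * derivative (scaledLaguerre n) +
    C (B n) * scaledLaguerre n with hQ
  have hcoeff : ∀ n k, (Q n).coeff k = a * ((scaledLaguerre n).coeff (k + 1) * (k + 1)) +
      B n * (scaledLaguerre n).coeff k := by
    intro n k
    simp [hQ, coeff_derivative]
  have hnn : ∀ n k, 0 ≤ a * ((scaledLaguerre n).coeff (k + 1) * (k + 1)) := fun n k => by
    have := scaledLaguerre_coeff_nonneg n (k + 1)
    positivity
  refine ⟨Q, fun n => ?_, fun n k => ?_, fun n => ?_, fun k => ?_⟩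
  · have := (hStable_scaledLaguerre n).derivative_add (x := (a : ℂ)) (by simp) (hBpos n)
    simpa [hQ, derivative_map] using this
  · rw [hcoeff]
    exact add_nonneg (hnn n k) (mul_nonneg (hBpos n).le (scaledLaguerre_coeff_nonneg n k))
  · rw [hcoeff]
    refine add_pos_of_nonneg_of_pos (hnn n 0) ?_
    rw [scaledLaguerre_coeff]
    simpa using hBpos n
  · simp only [hcoeff]
    have h1 := tendsto_scaledLaguerre_coeff (k + 1)
    have h2 := tendsto_scaledLaguerre_coeff k
    have := ((h1.mul_const ((k : ℝ) + 1)).const_mul a).add (hBlim.mul h2)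
    convert this using 2
    rw [Nat.factorial_succ]
    push_cast
    have hk : (k ! : ℝ) ≠ 0 := by positivity
    have hk1 : (k : ℝ) + 1 ≠ 0 := by positivity
    field_simp
    ring

/-! ### Factorizations and infinite products -/

theorem exists_multiset_prod_X_sub_C (s : Multiset ℂ)
    (hs : ∀ w ∈ s, ∃ t : ℝ, 0 < t ∧ w = -(t : ℂ)) :
    ∃ (c : ℂ) (M : Multiset ℝ), (∀ r ∈ M, 0 ≤ r) ∧
      (s.map (X - C ·)).prod = C c * (M.map fun r : ℝ => 1 + C (r : ℂ) * X).prod := by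
  induction s using Multiset.induction_on with
  | empty => exact ⟨1, 0, by simp, by simp⟩
  | cons w s ih =>
    obtain ⟨c, M, hM, h⟩ := ih fun v hv => hs v (Multiset.mem_cons_of_mem hv)
    obtain ⟨t, ht, rfl⟩ := hs w (Multiset.mem_cons_self w s)
    refine ⟨t * c, t⁻¹ ::ₘ M, ?_, ?_⟩
    · simpa [ht.le] using hM
    · have ht' : (t : ℂ) ≠ 0 := by exact_mod_cast ht.ne'
      have h1 : (X - C (-(t : ℂ)) : ℂ[X]) = C (t : ℂ) * (1 + C ((t⁻¹ : ℝ) : ℂ) * X) := by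
        rw [mul_add, ← mul_assoc, ← C_mul]
        simp [ht', add_comm]
      rw [Multiset.map_cons, Multiset.prod_cons, h, h1, Multiset.map_cons, Multiset.prod_cons,
        C_mul]
      ring

theorem exists_antitone_prod_eq (M : Multiset ℝ) (hM : ∀ r ∈ M, 0 ≤ r) :
    ∃ (N : ℕ) (r : ℕ → ℝ), Antitone r ∧ (∀ j, 0 ≤ r j) ∧ (∀ j, N ≤ j → r j = 0) ∧
      ∀ F : ℝ → ℂ[X], (M.map F).prod = ∏ j ∈ Finset.range N, F (r j) := by
  set L := M.sort (· ≥ ·) with hL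
  have hLM : (L : Multiset ℝ) = M := Multiset.sort_eq _ _
  have hL0 : ∀ r ∈ L, 0 ≤ r := fun r hr => hM r (by rw [← hLM]; exact hr)
  have hmem : ∀ j, 0 ≤ L.getD j 0 := fun j => by
    rcases lt_or_ge j L.length with h | h
    · rw [List.getD_eq_getElem _ _ h]; exact hL0 _ (List.getElem_mem h)
    · rw [List.getD_eq_default _ _ h]
  refine ⟨L.length, fun j => L.getD j 0, fun i j hij => ?_, hmem, fun j hj => ?_, fun F => ?_⟩
  · rcases lt_or_ge j L.length with h | h
    · have hi := lt_of_le_of_lt hij h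
      simp only [List.getD_eq_getElem _ _ h, List.getD_eq_getElem _ _ hi]
      rcases hij.eq_or_lt with rfl | hij
      · exact le_rfl
      · exact List.pairwise_iff_getElem.mp (Multiset.pairwise_sort M (· ≥ ·)) i j hi h hij
    · simp only [List.getD_eq_default _ _ h]
      exact hmem i
  · exact List.getD_eq_default _ _ hj
  · rw [← hLM, Multiset.map_coe, Multiset.prod_coe, Finset.prod_range,
      ← Fin.prod_univ_fun_getElem]
    exact Finset.prod_congr rfl fun i _ => by simp

/-- A polynomial with non-negative coefficients, positive constant term and only real zeros is
`Q(0) ∏ (1 + r_j x)`, where the `r_j ≥ 0` are listed in decreasing order and extended by `0`. -/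
theorem exists_antitone_factorization {Q : ℝ[X]} (hQ : HStable (Q.map (algebraMap ℝ ℂ)))
    (hnn : ∀ k, 0 ≤ Q.coeff k) (h0 : 0 < Q.coeff 0) :
    ∃ (N : ℕ) (r : ℕ → ℝ), Antitone r ∧ (∀ j, 0 ≤ r j) ∧ (∀ j, N ≤ j → r j = 0) ∧
      Q.coeff 1 = Q.coeff 0 * ∑ j ∈ Finset.range N, r j ∧
      ∀ z : ℂ, (Q.map (algebraMap ℝ ℂ)).eval z =
        (Q.coeff 0 : ℂ) * ∏ j ∈ Finset.range N, (1 + z * r j) := by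
  obtain ⟨c, M, hM, h⟩ := exists_multiset_prod_X_sub_C _
    (exists_pos_eq_neg_of_mem_roots hQ hnn h0)
  obtain ⟨N, r, hanti, hr, hN, hprod⟩ := exists_antitone_prod_eq M hM
  have hfac := (IsAlgClosed.splits (Q.map (algebraMap ℝ ℂ))).eq_prod_roots
  rw [h, hprod, ← mul_assoc, ← C_mul] at hfac
  set d := (Q.map (algebraMap ℝ ℂ)).leadingCoeff * c
  have hcoeff : ∀ n : ℕ, (∏ j ∈ Finset.range n, (1 + C (r j : ℂ) * X)).coeff 0 = 1 ∧
      (∏ j ∈ Finset.range n, (1 + C (r j : ℂ) * X)).coeff 1 =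
        ((∑ j ∈ Finset.range n, r j : ℝ) : ℂ) := by
    intro n
    induction n with
    | zero => simp [coeff_one]
    | succ n ih =>
      simp only [Finset.prod_range_succ, Finset.sum_range_succ, mul_add, mul_one, coeff_add]
      simp only [mul_comm _ (C (r n : ℂ) * X), mul_assoc, coeff_C_mul, coeff_X_mul_zero,
        coeff_X_mul, ih]
      simp
  have hd : d = Q.coeff 0 := by
    have := congrArg (fun P => P.coeff 0) hfac
    simpa [coeff_C_mul, (hcoeff N).1] using this.symm
  refine ⟨N, r, hanti, hr, hN, ?_, fun z => ?_⟩
  · have := congrArg (fun P => P.coeff 1) hfac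
    simp only [coeff_map, coeff_C_mul, (hcoeff N).2, hd, Complex.coe_algebraMap] at this
    exact_mod_cast this
  · rw [hfac, eval_mul, eval_C, hd, eval_prod]
    simp only [eval_add, eval_one, eval_mul, eval_C, eval_X, mul_comm z]

theorem norm_one_add_mul_exp_neg_sub_one_le (u : ℂ) :
    ‖(1 + u) * Complex.exp (-u) - 1‖ ≤ 2 * ‖u‖ ^ 2 * Real.exp ‖u‖ := by
  have h1 := Complex.norm_exp_sub_sum_le_norm_mul_exp (-u) 2
  have h2 := Complex.norm_exp_sub_sum_le_norm_mul_exp (-u) 1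
  simp only [Finset.sum_range_succ, Finset.sum_range_zero, Nat.factorial, norm_neg] at h1 h2
  norm_num at h1 h2
  have h3 : (1 + u) * Complex.exp (-u) - 1 =
      (Complex.exp (-u) - (1 + -u)) + u * (Complex.exp (-u) - 1) := by ring
  rw [h3]
  refine (norm_add_le _ _).trans ?_
  rw [norm_mul]
  have h4 := mul_le_mul_of_nonneg_left h2 (norm_nonneg u)
  calc _ ≤ _ := add_le_add h1 h4
    _ = _ := by ring

/-- Genus-one products with decreasing parameters of bounded sum converge when the parameters
do, since the `j`-th factor differs from `1` by at most a constant times `1 / (j + 1)²`. -/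
theorem tendsto_tprod_one_add_mul_exp {r : ℕ → ℕ → ℝ} {ρ : ℕ → ℝ} {S : ℝ}
    (hr : ∀ n j, 0 ≤ r n j) (hS : ∀ᶠ n in atTop, ∀ j, r n j ≤ S / (j + 1))
    (hlim : ∀ j, Tendsto (fun n => r n j) atTop (𝓝 (ρ j))) (z : ℂ) :
    Tendsto (fun n => ∏' j, (1 + z * r n j) * Complex.exp (-(z * r n j))) atTop
      (𝓝 (∏' j, (1 + z * ρ j) * Complex.exp (-(z * ρ j)))) := by
  have h := tendsto_tprod_one_add_of_dominated_convergence (𝓕 := atTop)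
    (f := fun n j => (1 + z * r n j) * Complex.exp (-(z * r n j)) - 1)
    (g := fun j => (1 + z * ρ j) * Complex.exp (-(z * ρ j)) - 1)
    (bound := fun j : ℕ => 2 * (‖z‖ * S) ^ 2 * Real.exp (‖z‖ * S) * (1 / ((j : ℝ) + 1) ^ 2))
    ?_ ?_ ?_
  · simpa using h
  · refine Summable.mul_left _ ?_
    have := (summable_nat_add_iff 1).mpr (Real.summable_one_div_nat_pow.mpr one_lt_two)
    simpa using this
  · intro j
    have h1 : Tendsto (fun n => z * (r n j : ℂ)) atTop (𝓝 (z * ρ j)) :=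
      ((Complex.continuous_ofReal.tendsto _).comp (hlim j)).const_mul z
    exact ((h1.const_add 1).mul ((Complex.continuous_exp.tendsto _).comp h1.neg)).sub_const 1
  · filter_upwards [hS] with n hn j
    refine (norm_one_add_mul_exp_neg_sub_one_le _).trans ?_
    have h1 : ‖z * (r n j : ℂ)‖ = ‖z‖ * r n j := by
      rw [norm_mul, Complex.norm_real, Real.norm_of_nonneg (hr n j)]
    have hS0 : 0 ≤ S := by simpa using (hr n 0).trans (hn 0)
    have h2 : r n j ≤ S := (hn j).trans (div_le_self hS0 (by simp))
    rw [h1]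
    calc 2 * (‖z‖ * r n j) ^ 2 * Real.exp (‖z‖ * r n j)
        ≤ 2 * (‖z‖ * (S / (j + 1))) ^ 2 * Real.exp (‖z‖ * S) := by
          have := hr n j
          have := hn j
          gcongr
      _ = _ := by field_simp

/-- The parameters `ρ_j` of a product `∏ (1 + ρ_j z)` in decreasing order become the `1 / x_k`
of the type I representation; the number `ω` of factors is the number of non-zero `ρ_j`. -/
theorem exists_type_I_product {ρ : ℕ → ℝ} (hanti : Antitone ρ) (hρ : ∀ j, 0 ≤ ρ j)
    (hsum : Summable ρ) :
    ∃ (ω : ℕ∞) (x : {k : ℕ // (k : ℕ∞) < ω} → ℝ), (∀ k, 0 < x k) ∧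
      Summable (fun k => 1 / x k) ∧
      ∀ z : ℂ, ∏' k, (1 + z / (x k : ℂ)) = ∏' j, (1 + z * ρ j) := by
  obtain ⟨ω, hω⟩ : ∃ ω : ℕ∞, ∀ k : ℕ, (k : ℕ∞) < ω ↔ 0 < ρ k := by
    classical
    by_cases h : ∃ k, ρ k = 0
    · refine ⟨(Nat.find h : ℕ), fun k => ?_⟩
      rw [Nat.cast_lt]
      refine ⟨fun hk => (hρ k).lt_of_ne' (Nat.find_min h hk), fun hk => ?_⟩
      by_contra! hle
      have := hanti hle
      rw [Nat.find_spec h] at this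
      linarith
    · push Not at h
      exact ⟨⊤, fun k => by simp [(hρ k).lt_of_ne' (h k)]⟩
  refine ⟨ω, fun k => 1 / ρ k, fun k => one_div_pos.mpr ((hω k).mp k.2), ?_, fun z => ?_⟩
  · simp only [one_div_one_div]
    exact hsum.subtype _
  · rw [← tprod_subtype_eq_of_mulSupport_subset (s := {k : ℕ | (k : ℕ∞) < ω})]
    · refine tprod_congr fun k => ?_
      simp
    · intro k hk
      rw [Set.mem_ofPred_eq, hω]
      refine (hρ k).lt_of_ne' fun h0 => hk ?_
      simp [h0]

/-! ### Laguerre's theorem on limits of polynomials with negative zeros -/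

/-- For polynomials with non-negative coefficients, a bound `B` on the positive axis dominates
the terms at `z` by `B(2‖z‖) / 2^k`, so that coefficientwise convergence implies pointwise
convergence. -/
theorem tendsto_eval_of_tendsto_coeff {Q : ℕ → ℝ[X]} {β : ℕ → ℝ} {B : ℝ → ℝ}
    (hnn : ∀ n k, 0 ≤ (Q n).coeff k)
    (hlim : ∀ k, Tendsto (fun n => (Q n).coeff k) atTop (𝓝 (β k)))
    (hB : ∀ t : ℝ, 0 ≤ t → ∀ᶠ n in atTop, (Q n).eval t ≤ B t) {z F : ℂ}
    (hF : HasSum (fun k => (β k : ℂ) * z ^ k) F) :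
    Tendsto (fun n => ((Q n).map (algebraMap ℝ ℂ)).eval z) atTop (𝓝 F) := by
  rw [← hF.tsum_eq]
  have hsum : ∀ n, ((Q n).map (algebraMap ℝ ℂ)).eval z =
      ∑' k, ((Q n).coeff k : ℂ) * z ^ k := by
    intro n
    rw [eval_eq_sum_range, natDegree_map, tsum_eq_sum (s := Finset.range ((Q n).natDegree + 1))]
    · simp
    · intro k hk
      rw [coeff_eq_zero_of_natDegree_lt (by simpa using hk)]
      simp
  simp only [hsum]
  refine tendsto_tsum_of_dominated_convergence
    (bound := fun k => B (2 * ‖z‖) * (1 / 2) ^ k)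
    (summable_geometric_two.mul_left _) (fun k => ?_) ?_
  · exact ((Complex.continuous_ofReal.tendsto _).comp (hlim k)).mul_const _
  · filter_upwards [hB (2 * ‖z‖) (by positivity)] with n hn k
    have h1 : (Q n).coeff k * (2 * ‖z‖) ^ k ≤ (Q n).eval (2 * ‖z‖) := by
      rw [eval_eq_sum_range]
      rcases lt_or_ge k ((Q n).natDegree + 1) with hk | hk
      · exact Finset.single_le_sum (f := fun i => (Q n).coeff i * (2 * ‖z‖) ^ i)
          (fun i _ => mul_nonneg (hnn n i) (by positivity)) (Finset.mem_range.mpr hk)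
      · rw [coeff_eq_zero_of_natDegree_lt (by omega), zero_mul]
        exact Finset.sum_nonneg fun i _ => mul_nonneg (hnn n i) (by positivity)
    rw [norm_mul, norm_pow, Complex.norm_real, Real.norm_of_nonneg (hnn n k)]
    calc (Q n).coeff k * ‖z‖ ^ k = (Q n).coeff k * (2 * ‖z‖) ^ k * (1 / 2) ^ k := by
          rw [mul_pow, mul_assoc, mul_right_comm, ← mul_pow]
          norm_num
      _ ≤ _ := by
          have := h1.trans hn
          gcongr

/-- Laguerre's theorem: a limit of polynomials with only negative real zeros is of type I; as its
constant term is positive, there is no factor `z^m`. Along a subsequence the negated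
reciprocals of the zeros converge to some `ρ_j`; the part of `∑_j r_{n,j}` that escapes in the
limit produces the exponential factor. -/
theorem IsStableLimit.exists_type_I {β : ℕ → ℝ} (h : IsStableLimit β) (hβ : 0 < β 0)
    {F : ℂ → ℂ} (hF : ∀ z, HasSum (fun k => (β k : ℂ) * z ^ k) (F z)) :
    ∃ (σ : ℝ) (ω : ℕ∞) (x : {k : ℕ // (k : ℕ∞) < ω} → ℝ),
      0 ≤ σ ∧ (∀ k, 0 < x k) ∧ Summable (fun k => 1 / x k) ∧
      ∀ z : ℂ, F z = (β 0 : ℂ) * Complex.exp ((σ : ℂ) * z) * ∏' k, (1 + z / (x k : ℂ)) := by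
  obtain ⟨Q, hQ, hnn, h0, hlim⟩ := h
  choose N r hanti hr hN hsum hprod using fun n => exists_antitone_factorization (hQ n) (hnn n) (h0 n)
  set s : ℕ → ℝ := fun n => ∑ j ∈ Finset.range (N n), r n j with hs
  have hslim : Tendsto s atTop (𝓝 (β 1 / β 0)) := by
    refine ((hlim 1).div (hlim 0) hβ.ne').congr fun n => ?_
    simp only [Pi.div_apply, hsum n]
    exact mul_div_cancel_left₀ _ (h0 n).ne'
  set S := β 1 / β 0 + 1 with hSdef
  have hS : ∀ᶠ n in atTop, s n ≤ S := (hslim.eventually_lt_const (lt_add_one _)).mono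
    fun n hn => hn.le
  have hrsum : ∀ n, HasSum (r n) (s n) := fun n =>
    hasSum_sum_of_ne_finset_zero fun j hj => hN n j (by simpa using hj)
  have hpart : ∀ n m, ∑ j ∈ Finset.range m, r n j ≤ s n := fun n m =>
    sum_le_hasSum _ (fun j _ => hr n j) (hrsum n)
  have hrS : ∀ᶠ n in atTop, ∀ j, r n j ≤ S / (j + 1) := by
    filter_upwards [hS] with n hn j
    rw [le_div_iff₀ (by positivity)]
    -- `r_j` is the least of the first `j + 1` terms.
    have h1 := Finset.card_nsmul_le_sum (Finset.range (j + 1)) (r n) (r n j)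
      fun i hi => hanti n (Nat.lt_succ_iff.mp (Finset.mem_range.mp hi))
    have h2 := hpart n (j + 1)
    simp only [Finset.card_range, nsmul_eq_mul] at h1
    push_cast at h1
    linarith
  -- Extraction of a subsequence along which all the parameters converge.
  obtain ⟨ρ, -, τ, hτ, hρlim⟩ :=
    (isCompact_univ_pi fun _ : ℕ => (isCompact_Icc : IsCompact (Set.Icc (0 : ℝ) S))).tendsto_subseq'
      (x := r) (hrS.mono fun n hn j _ => ⟨hr n j, (hn j).trans (div_le_self
        (by simpa using (hr n 0).trans (hn 0)) (by simp))⟩).frequently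
  rw [tendsto_pi_nhds] at hρlim
  have hτt := hτ.tendsto_atTop
  have hρ : ∀ j, 0 ≤ ρ j := fun j => ge_of_tendsto' (hρlim j) fun n => hr _ j
  have hρanti : Antitone ρ := fun i j hij =>
    le_of_tendsto_of_tendsto' (hρlim j) (hρlim i) fun n => hanti _ hij
  have hρpart : ∀ m, ∑ j ∈ Finset.range m, ρ j ≤ β 1 / β 0 := fun m =>
    le_of_tendsto_of_tendsto' (tendsto_finsetSum _ fun j _ => hρlim j) (hslim.comp hτt)
      fun n => hpart _ m
  have hρsum : Summable ρ := summable_of_sum_range_le hρ hρpart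
  obtain ⟨ω, x, hx, hxsum, hxprod⟩ := exists_type_I_product hρanti hρ hρsum
  refine ⟨β 1 / β 0 - ∑' j, ρ j, ω, x,
    sub_nonneg.mpr (Real.tsum_le_of_sum_range_le hρ hρpart), hx, hxsum, fun z => ?_⟩
  have hprod' : ∀ (z : ℂ) (n : ℕ), ((Q n).map (algebraMap ℝ ℂ)).eval z =
      (Q n).coeff 0 * Complex.exp (z * s n) *
        ∏' j, (1 + z * r n j) * Complex.exp (-(z * r n j)) := by
    intro z n
    rw [tprod_eq_prod (s := Finset.range (N n)) fun j hj => by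
      rw [hN n j (by simpa using hj)]; simp, Finset.prod_mul_distrib, ← Complex.exp_sum,
      Finset.sum_neg_distrib, ← Finset.mul_sum, hprod n z, hs]
    push_cast
    rw [Complex.exp_neg]
    field_simp [Complex.exp_ne_zero]
  have hB : ∀ t : ℝ, 0 ≤ t → ∀ᶠ n in atTop,
      (Q n).eval t ≤ (β 0 + 1) * Real.exp (t * S) := by
    intro t ht
    filter_upwards [hS, (hlim 0).eventually_lt_const (lt_add_one _)] with n hn hn0
    have h1 : (Q n).eval t = (Q n).coeff 0 * ∏ j ∈ Finset.range (N n), (1 + t * r n j) := by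
      have := hprod n t
      rw [← Complex.coe_algebraMap, eval_map, eval₂_at_apply, Complex.coe_algebraMap] at this
      exact_mod_cast this
    rw [h1]
    have h2 : ∏ j ∈ Finset.range (N n), (1 + t * r n j) ≤ Real.exp (t * S) := by
      calc _ ≤ ∏ j ∈ Finset.range (N n), Real.exp (t * r n j) :=
            Finset.prod_le_prod (fun j _ => by have := hr n j; positivity)
              fun j _ => by rw [add_comm]; exact Real.add_one_le_exp _
        _ = Real.exp (t * s n) := by rw [← Real.exp_sum, ← Finset.mul_sum]
        _ ≤ _ := by gcongr
    have h3 := h0 n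
    exact mul_le_mul hn0.le h2 (Finset.prod_nonneg fun j _ => by have := hr n j; positivity)
      (by linarith)
  have hlim1 := (tendsto_eval_of_tendsto_coeff hnn hlim hB (hF z)).comp hτt
  have hlim2 : Tendsto (fun n => ((Q (τ n)).map (algebraMap ℝ ℂ)).eval z) atTop
      (𝓝 (β 0 * Complex.exp (z * (β 1 / β 0 : ℝ)) *
        ∏' j, (1 + z * ρ j) * Complex.exp (-(z * ρ j)))) := by
    simp only [hprod']
    have hof : ∀ {u : ℕ → ℝ} {c : ℝ}, Tendsto u atTop (𝓝 c) →
        Tendsto (fun n => (u n : ℂ)) atTop (𝓝 c) :=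
      fun hu => (Complex.continuous_ofReal.tendsto _).comp hu
    refine ((hof ((hlim 0).comp hτt)).mul ((Complex.continuous_exp.tendsto _).comp
      ((hof (hslim.comp hτt)).const_mul z))).mul ?_
    exact tendsto_tprod_one_add_mul_exp (r := fun n => r (τ n)) (fun n => hr _)
      (hτt.eventually hrS) hρlim z
  rw [tendsto_nhds_unique hlim1 hlim2, hxprod]
  have hρc : HasSum (fun j => -(z * (ρ j : ℂ))) (-(z * ((∑' j, ρ j : ℝ) : ℂ))) :=
    ((Complex.hasSum_ofReal.mpr hρsum.hasSum).mul_left z).neg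
  have hm : Multipliable fun j => 1 + z * (ρ j : ℂ) := by
    refine multipliable_one_add_of_summable ?_
    simpa [norm_mul, Complex.norm_real, Real.norm_of_nonneg (hρ _)] using hρsum.mul_left ‖z‖
  have hE := hρc.cexp
  have : ∏' j, (1 + z * ρ j) * Complex.exp (-(z * ρ j)) =
      (∏' j, (1 + z * (ρ j : ℂ))) * Complex.exp (-(z * ((∑' j, ρ j : ℝ) : ℂ))) :=
    (hm.hasProd.mul hE).tprod_eq
  have hexp : Complex.exp (((β 1 / β 0 - ∑' j, ρ j : ℝ) : ℂ) * z) =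
      Complex.exp (z * (β 1 / β 0 : ℝ)) * Complex.exp (-(z * ((∑' j, ρ j : ℝ) : ℂ))) := by
    rw [← Complex.exp_add]
    congr 1
    push_cast
    ring
  rw [this, hexp]
  ring

/-! ### The Bessel series and the quadratic sequences -/

theorem summable_pow_div_factorial_sq (z : ℂ) : Summable fun k : ℕ => z ^ k / (k ! : ℂ) ^ 2 := by
  refine Summable.of_norm_bounded (Real.summable_pow_div_factorial ‖z‖) fun k => ?_
  have h1 : (1 : ℝ) ≤ k ! := by exact_mod_cast Nat.factorial_pos k
  rw [norm_div, norm_pow, norm_pow, Complex.norm_natCast]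
  gcongr
  nlinarith

theorem summable_pow_div_factorial_mul_succ (z : ℂ) :
    Summable fun k : ℕ => z ^ k / ((k ! : ℂ) * ((k + 1)! : ℂ)) := by
  refine Summable.of_norm_bounded (Real.summable_pow_div_factorial ‖z‖) fun k => ?_
  have h1 : (1 : ℝ) ≤ (k + 1)! := by exact_mod_cast Nat.factorial_pos (k + 1)
  have h2 : (0 : ℝ) < k ! := by positivity
  rw [norm_div, norm_pow, norm_mul, Complex.norm_natCast, Complex.norm_natCast]
  gcongr
  nlinarith

theorem besselI_zero_two_mul (w : ℂ) :
    besselI 0 (2 * w) = ∑' k : ℕ, (w ^ 2) ^ k / (k ! : ℂ) ^ 2 := by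
  rw [besselI, Complex.ofReal_zero, Complex.cpow_zero, one_mul]
  refine tsum_congr fun k => ?_
  rw [add_zero, Complex.Gamma_nat_eq_factorial, mul_div_cancel_left₀ _ two_ne_zero, pow_mul, sq]
  ring

theorem besselI_one_two_mul (w : ℂ) :
    besselI 1 (2 * w) = w * ∑' k : ℕ, (w ^ 2) ^ k / ((k ! : ℂ) * ((k + 1)! : ℂ)) := by
  rw [besselI, Complex.ofReal_one, Complex.cpow_one, mul_div_cancel_left₀ _ two_ne_zero]
  congr 1
  refine tsum_congr fun k => ?_
  have := Complex.Gamma_nat_eq_factorial (k + 1)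
  push_cast at this
  rw [this, pow_mul]

/-- `∑ (c k² + a k) z^k / k!²` with its vanishing constant term dropped and one factor `z`
removed. -/
theorem hasSum_quadratic_succ (a c : ℝ) (z : ℂ) :
    HasSum (fun k : ℕ => (((c * ((k + 1 : ℕ) : ℝ) ^ 2 + a * ((k + 1 : ℕ) : ℝ)) /
        ((k + 1)! : ℝ) ^ 2 : ℝ) : ℂ) * z ^ k)
      (c * (∑' k : ℕ, z ^ k / (k ! : ℂ) ^ 2) +
        a * ∑' k : ℕ, z ^ k / ((k ! : ℂ) * ((k + 1)! : ℂ))) := by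
  convert ((summable_pow_div_factorial_sq z).hasSum.mul_left (c : ℂ)).add
    ((summable_pow_div_factorial_mul_succ z).hasSum.mul_left (a : ℂ)) using 1
  · rfl
  funext k
  have hk : (k ! : ℂ) ≠ 0 := by exact_mod_cast Nat.factorial_ne_zero k
  have hk1 : (k : ℂ) + 1 ≠ 0 := by exact_mod_cast Nat.succ_ne_zero k
  rw [Nat.factorial_succ]
  push_cast
  field_simp

theorem hasSum_quadratic (a b c : ℝ) (z : ℂ) :
    HasSum (fun k : ℕ => (((c * (k : ℝ) ^ 2 + a * (k : ℝ) + b) / (k ! : ℝ) ^ 2 : ℝ) : ℂ) * z ^ k)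
      ((b + c * z) * (∑' k : ℕ, z ^ k / (k ! : ℂ) ^ 2) +
        a * z * ∑' k : ℕ, z ^ k / ((k ! : ℂ) * ((k + 1)! : ℂ))) := by
  have h1 := (summable_pow_div_factorial_sq z).hasSum.mul_left (b : ℂ)
  have h2 : HasSum
      (fun k : ℕ => (((c * (k : ℝ) ^ 2 + a * (k : ℝ)) / (k ! : ℝ) ^ 2 : ℝ) : ℂ) * z ^ k)
      (z * (c * (∑' k : ℕ, z ^ k / (k ! : ℂ) ^ 2) +
        a * ∑' k : ℕ, z ^ k / ((k ! : ℂ) * ((k + 1)! : ℂ)))) := by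
    have h3 := (hasSum_quadratic_succ a c z).mul_left z
    simp only [mul_left_comm z, ← pow_succ'] at h3
    have h4 := (hasSum_nat_add_iff (f := fun k : ℕ =>
      (((c * (k : ℝ) ^ 2 + a * (k : ℝ)) / (k ! : ℝ) ^ 2 : ℝ) : ℂ) * z ^ k) 1).mp h3
    simpa using h4
  have h5 : (b + c * z) * (∑' k : ℕ, z ^ k / (k ! : ℂ) ^ 2) +
        a * z * ∑' k : ℕ, z ^ k / ((k ! : ℂ) * ((k + 1)! : ℂ)) =
      b * (∑' k : ℕ, z ^ k / (k ! : ℂ) ^ 2) + z * (c * (∑' k : ℕ, z ^ k / (k ! : ℂ) ^ 2) +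
        a * ∑' k : ℕ, z ^ k / ((k ! : ℂ) * ((k + 1)! : ℂ))) := by ring
  rw [h5]
  convert h1.add h2 using 1
  · rfl
  funext k
  push_cast
  ring

theorem isLaguerrePolyaPlus_quadratic {a b c : ℝ} (ha : 0 ≤ a) (hb : 0 ≤ b) (hc : 0 ≤ c) :
    IsLaguerrePolyaPlus (fun z : ℂ => ∑' k : ℕ,
      (((c * (k : ℝ) ^ 2 + a * (k : ℝ) + b) / ((k ! : ℝ) ^ 2) : ℝ) : ℂ) * z ^ k) := by
  refine ⟨fun k => (c * (k : ℝ) ^ 2 + a * (k : ℝ) + b) / (k ! : ℝ), fun z => ?_, Or.inl ?_,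
    fun k => by positivity⟩
  · convert (hasSum_quadratic a b c z).summable.hasSum using 4 with k
    rw [div_div, sq (k ! : ℝ)]
  rcases hb.eq_or_lt with rfl | hb
  · rcases (add_nonneg hc ha).eq_or_lt with h | h
    · have ha0 : a = 0 := by linarith
      have hc0 : c = 0 := by linarith
      refine ⟨0, 0, 0, 0, fun _ => 1, le_rfl, fun _ => one_pos, ?_, fun z => ?_⟩
      · have : IsEmpty {k : ℕ // (k : ℕ∞) < 0} := ⟨fun k => not_lt_zero k.2⟩
        exact summable_empty
      · simp [ha0, hc0]
    · obtain ⟨σ, ω, x, hσ, hx, hxs, hrep⟩ := (isStableLimit_quadratic_succ ha hc).exists_type_I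
        (by simpa using h) (hasSum_quadratic_succ a c)
      refine ⟨c + a, 1, σ, ω, x, hσ, hx, hxs, fun z => (hasSum_quadratic a 0 c z).tsum_eq.trans ?_⟩
      have := hrep z
      simp only [zero_add, Nat.cast_one, one_pow, mul_one, Nat.factorial_one, div_one] at this
      push_cast at this ⊢
      linear_combination z * this
  · obtain ⟨σ, ω, x, hσ, hx, hxs, hrep⟩ := (isStableLimit_quadratic ha hb.le hc).exists_type_I
      (by simpa using hb) (hasSum_quadratic a b c)
    refine ⟨b, 0, σ, ω, x, hσ, hx, hxs, fun z => (hasSum_quadratic a b c z).tsum_eq.trans ?_⟩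
    rw [pow_zero, mul_one]
    simpa using hrep z

/-- The operator sends `(x + 1)²` to `6 x² + 6 x + 2`, whose discriminant is negative. -/
theorem not_isMultiplierSequence_sq_add_two :
    ¬ IsMultiplierSequence (fun k : ℕ => (k : ℝ) ^ 2 + 2) := by
  intro h
  have h1 : nonrealZeroCount (X ^ 2 + (2 : ℝ) • X ^ 1 + X ^ 0) = 0 := by
    refine (nonrealZeroCount_eq_zero_iff _).mpr (Or.inr fun y hy h0 => ?_)
    simp only [Polynomial.map_add, Polynomial.map_smul, Polynomial.map_pow, map_X, eval_add,
      eval_smul, eval_pow, eval_X, smul_eq_mul, Complex.coe_algebraMap, Complex.ofReal_ofNat] at h0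
    have h2 : (y + 1) ^ 2 = 0 := by linear_combination h0
    have h3 := congrArg Complex.im (pow_eq_zero_iff two_ne_zero |>.mp h2)
    simp only [Complex.add_im, Complex.one_im, add_zero, Complex.zero_im] at h3
    exact hy.ne' h3
  have h2 := (nonrealZeroCount_eq_zero_iff _).mp (h _ h1)
  simp only [map_add, map_smul, diagonalOperator_X_pow] at h2
  rcases h2 with h2 | h2
  · have := congrArg (fun p => p.eval 0) h2
    norm_num at this
  · refine h2 (-1 / 2 + (Real.sqrt 3 / 6 : ℝ) * Complex.I) ?_ ?_
    · simp
    · have hs : ((Real.sqrt 3 : ℝ) : ℂ) ^ 2 = 3 := by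
        exact_mod_cast Real.sq_sqrt (by norm_num : (0 : ℝ) ≤ 3)
      simp only [Polynomial.map_add, Polynomial.map_smul, Polynomial.map_pow, map_X, eval_add,
        eval_smul, eval_pow, eval_X, smul_eq_mul, Complex.coe_algebraMap]
      push_cast
      linear_combination (6 * Complex.I ^ 2 / 36) * hs + (1 / 2) * Complex.I_sq

end

theorem mainTheorem11 :
    (∀ a b c : ℝ, 0 ≤ a → 0 ≤ b → 0 ≤ c →
      IsMultiplierSequence (fun k : ℕ => (c * (k : ℝ) ^ 2 + a * (k : ℝ) + b) / (k ! : ℝ)) ∧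
      (∀ z w : ℂ, w ^ 2 = z →
        HasSum (fun k : ℕ =>
            (((c * (k : ℝ) ^ 2 + a * (k : ℝ) + b) / ((k ! : ℝ) ^ 2) : ℝ) : ℂ) * z ^ k)
          (((b : ℂ) + (c : ℂ) * z) * besselI 0 (2 * w) + (a : ℂ) * w * besselI 1 (2 * w))) ∧
      IsLaguerrePolyaPlus (fun z : ℂ => ∑' k : ℕ,
        (((c * (k : ℝ) ^ 2 + a * (k : ℝ) + b) / ((k ! : ℝ) ^ 2) : ℝ) : ℂ) * z ^ k)) ∧
    ¬ IsMultiplierSequence (fun k : ℕ => (k : ℝ) ^ 2 + 2) := by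
  refine ⟨fun a b c ha hb hc => ⟨?_, ?_, isLaguerrePolyaPlus_quadratic ha hb hc⟩,
    not_isMultiplierSequence_sq_add_two⟩
  · convert (isStableLimit_quadratic ha hb hc).isMultiplierSequence using 2 with k
    have hk : (k ! : ℝ) ≠ 0 := by positivity
    field_simp
  · rintro z w rfl
    rw [besselI_zero_two_mul, besselI_one_two_mul]
    convert hasSum_quadratic a b c (w ^ 2) using 1
    ring
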